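/- Let $n\ge 1$ and let $P_n$ be the unweighted path with vertices $1,\dots,n$, in which $i$ and $i+1$ are adjacent for $1\le i<n$. Let $L(P_n)=\Delta-A$ be its Laplacian matrix, where $A$ is the adjacency matrix and $\Delta$ the diagonal matrix of vertex degrees. (This is, up to rescaling and shift, the Heisenberg (XYZ) Hamiltonian of the chain of $n$ qubits restricted to the single-excitation subspace.) For a real symmetric matrix $M$ whose rows and columns are indexed by a finite set $V$, and $a,b\in V$, say that $M$ admits *pretty good state transfer* between $a$ and $b$ if for every $\epsilon>0$ there is a time $\tau>0$ such that $|\exp(\mathrm{i}\tau M)_{a,b}|>1-\epsilon$. Then $L(P_n)$ admits pretty good state transfer between the end vertices $1$ and $n$ if and only if $n$ is a power of $2$ (that is, $n=2^k$ for some integer $k\ge 0$). Moreover, if $n$ is a power of $2$, then $L(P_n)$ admits pretty good state transfer between the vertices $j$ and $n+1-j$ for every $j=1,\dots,n$. -/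

import Mathlib

/-- The transition matrix `U(t) = exp(i t M)` of the continuous-time quantum walk on a real
matrix `M`, as a complex matrix. -/
noncomputable def transitionMatrix {V : Type*} [Fintype V] [DecidableEq V]
    (M : Matrix V V ℝ) (t : ℝ) : Matrix V V ℂ :=
  NormedSpace.exp ((Complex.I * (t : ℂ)) • M.map Complex.ofReal)

/-- `M` admits pretty good state transfer between `a` and `b`: for every `ε > 0` there is a time
`τ > 0` with `|U(τ)_{a,b}| > 1 - ε`. -/
def PrettyGoodStateTransfer {V : Type*} [Fintype V] [DecidableEq V]
    (M : Matrix V V ℝ) (a b : V) : Prop :=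
  ∀ ε : ℝ, 0 < ε → ∃ τ : ℝ, 0 < τ ∧ ‖transitionMatrix M τ a b‖ > 1 - ε

open scoped Classical in
/-- The XYZ (Heisenberg) Hamiltonian of a graph, in the single-excitation subspace and up to
rescaling and shift: the Laplacian matrix `Δ(G) - A(G)`. -/
noncomputable def hamiltonianXYZ {V : Type*} [Fintype V] (G : SimpleGraph V) : Matrix V V ℝ :=
  G.lapMatrix ℝ

/-! The path Laplacian has cosine eigenvectors with eigenvalues `2 - 2 cos (π r / n)`. Up to phase
and conjugation, the amplitude between mirror vertices is a convex combination of the numbers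
`(-1)^r z_r`, where `z_s = exp(2iτ cos(π s / n))`. Pretty good transfer means that modulus 1 is
attained on the compact closure of this torus orbit. For end vertices, equality in the triangle
inequality then forces `z_r = (-1)^r c` for every `r < 2n`, `r ≠ n`.

Vanishing sums of cosines become multiplicative relations on the closure. If an odd `p > 1` divides
`n`, relations from equally spaced angles contradict the alternation. If `n = 2^(m+1)`, the cosines
with `s < 2^m` are rationally independent, so Kronecker's theorem prescribes those `z_s` freely, and
the reflections `s ↦ n - s`, `s ↦ 2n - s` carry the alternation to the other indices. -/

/-! ### Kronecker's approximation theorem -/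

/-- A bounded trigonometric polynomial has coefficients at most its bound. -/
theorem norm_coeff_le_of_trigPoly_bounded {κ : Type*} (S : Finset κ) (a : κ → ℂ) (μ : κ → ℝ)
    (B : ℝ) (k₀ : κ) (hk₀ : k₀ ∈ S) (hμ : ∀ k ∈ S, k ≠ k₀ → μ k ≠ μ k₀)
    (hB : ∀ t : ℝ, 0 < t → ‖∑ k ∈ S, a k * Complex.exp ((μ k * t : ℝ) * Complex.I)‖ ≤ B) :
    ‖a k₀‖ ≤ B := by
  classical
  set ν : κ → ℂ := fun k => ((μ k - μ k₀ : ℝ) : ℂ) * Complex.I with hν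
  set f : ℝ → ℂ := fun t => a k₀ + ∑ k ∈ S.erase k₀, a k * Complex.exp (ν k * t) with hf
  have hfB : ∀ t : ℝ, 0 < t → ‖f t‖ ≤ B := by
    intro t ht
    have : f t = Complex.exp ((-(μ k₀ * t) : ℝ) * Complex.I) *
        ∑ k ∈ S, a k * Complex.exp ((μ k * t : ℝ) * Complex.I) := by
      rw [← Finset.add_sum_erase S _ hk₀, mul_add, Finset.mul_sum]
      simp only [hf, hν]
      congr 1
      · rw [mul_left_comm, ← Complex.exp_add]
        rw [show (((-(μ k₀ * t) : ℝ) : ℂ) * Complex.I + ((μ k₀ * t : ℝ) : ℂ) * Complex.I) = 0 by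
          push_cast; ring]
        simp
      · refine Finset.sum_congr rfl fun k _ => ?_
        rw [mul_left_comm, ← Complex.exp_add]
        congr 2
        push_cast; ring
    rw [this, norm_mul, Complex.norm_exp_ofReal_mul_I, one_mul]
    exact hB t ht
  have hν0 : ∀ k ∈ S.erase k₀, ν k ≠ 0 := by
    intro k hk
    rw [Finset.mem_erase] at hk
    simp only [hν, ne_eq, mul_eq_zero, Complex.I_ne_zero, or_false, Complex.ofReal_eq_zero]
    exact sub_ne_zero.mpr (hμ k hk.2 hk.1)
  set C : ℝ := ∑ k ∈ S.erase k₀, ‖a k‖ * (2 / ‖ν k‖) with hC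
  -- Integrating over `[0, T]`: the constant term of `f` grows linearly, while the oscillating terms
  -- contribute at most `C`.
  have key : ∀ T : ℝ, 0 < T → T * ‖a k₀‖ ≤ B * T + C := by
    intro T hT
    have hint : ∫ t in (0 : ℝ)..T, f t = T * a k₀ +
        ∑ k ∈ S.erase k₀, a k * ((Complex.exp (ν k * T) - 1) / ν k) := by
      simp only [hf]
      rw [intervalIntegral.integral_add, intervalIntegral.integral_finsetSum]
      · congr 1
        · simp
        · refine Finset.sum_congr rfl fun k hk => ?_
          rw [intervalIntegral.integral_const_mul, integral_exp_mul_complex (hν0 k hk)]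
          simp
      · intro k _
        exact Continuous.intervalIntegrable (by fun_prop) _ _
      · exact Continuous.intervalIntegrable (by fun_prop) _ _
      · exact Continuous.intervalIntegrable (by fun_prop) _ _
    have h1 : ‖∫ t in (0 : ℝ)..T, f t‖ ≤ B * |T - 0| :=
      intervalIntegral.norm_integral_le_of_norm_le_const fun t ht => by
        rw [Set.uIoc_of_le hT.le] at ht
        exact hfB t ht.1
    rw [sub_zero, abs_of_pos hT] at h1
    have h2 : ‖∑ k ∈ S.erase k₀, a k * ((Complex.exp (ν k * T) - 1) / ν k)‖ ≤ C := by
      refine (norm_sum_le _ _).trans (Finset.sum_le_sum fun k _ => ?_)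
      rw [norm_mul, norm_div]
      gcongr
      refine (norm_sub_le _ _).trans ?_
      rw [show ν k * (T : ℂ) = (((μ k - μ k₀) * T : ℝ) : ℂ) * Complex.I by
        simp only [hν]; push_cast; ring, Complex.norm_exp_ofReal_mul_I]
      norm_num
    have h3 : (T : ℂ) * a k₀ = (∫ t in (0 : ℝ)..T, f t) -
        ∑ k ∈ S.erase k₀, a k * ((Complex.exp (ν k * T) - 1) / ν k) := by
      rw [hint]; ring
    have h4 : ‖(T : ℂ) * a k₀‖ = T * ‖a k₀‖ := by
      rw [norm_mul, Complex.norm_real, Real.norm_of_nonneg hT.le]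
    rw [← h4, h3]
    exact (norm_sub_le _ _).trans (add_le_add h1 h2)
  by_contra! hlt
  have hd : 0 < ‖a k₀‖ - B := by linarith
  have hC0 : 0 ≤ C := Finset.sum_nonneg fun k _ => by positivity
  have := key ((C + 1) / (‖a k₀‖ - B)) (by positivity)
  have h5 : (C + 1) / (‖a k₀‖ - B) * (‖a k₀‖ - B) = C + 1 := by field_simp
  linarith

theorem Complex.norm_one_add_sq_le {z : ℂ} (hz : ‖z‖ = 1) {ε : ℝ} (hε : 0 ≤ ε)
    (h : ε ≤ ‖z - 1‖) : ‖1 + z‖ ^ 2 ≤ 4 - ε ^ 2 := by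
  have h1 := parallelogram_law_with_norm ℝ z 1
  rw [hz, norm_one, add_comm z 1] at h1
  nlinarith

/-- Kronecker's theorem on simultaneous approximation. -/
theorem exists_pos_forall_norm_exp_sub_lt {ι : Type*} [Fintype ι] (lam : ι → ℝ)
    (hlam : ∀ c : ι → ℤ, ∑ i, c i * lam i = 0 → c = 0) (g : ι → ℂ) (hg : ∀ i, ‖g i‖ = 1)
    {ε : ℝ} (hε : 0 < ε) :
    ∃ t : ℝ, 0 < t ∧ ∀ i, ‖Complex.exp ((lam i * t : ℝ) * Complex.I) - g i‖ < ε := by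
  classical
  by_contra! hcon
  set N := Fintype.card ι with hN
  set r : ℝ := (4 - ε ^ 2) / 4 with hr
  -- Each factor has modulus at most `4^p`, and a coordinate that misses its target by `ε` gains an
  -- extra `r^p`.
  have hbound : ∀ t : ℝ, 0 < t → ∀ p : ℕ,
      ‖∏ i, (starRingEnd ℂ (g i) * Complex.exp ((lam i * t : ℝ) * Complex.I) + 1) ^ (2 * p)‖
        ≤ r ^ p * (4 ^ p) ^ N := by
    intro t ht p
    obtain ⟨i₀, hi₀⟩ := hcon t ht
    set z : ι → ℂ := fun i => starRingEnd ℂ (g i) * Complex.exp ((lam i * t : ℝ) * Complex.I)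
      with hz
    have hz1 : ∀ i, ‖z i‖ = 1 := fun i => by
      simp only [hz]
      rw [norm_mul, Complex.norm_exp_ofReal_mul_I, mul_one, RCLike.norm_conj, hg]
    have hz2 : ε ≤ ‖z i₀ - 1‖ := by
      refine hi₀.trans (le_of_eq ?_)
      have : z i₀ - 1 = starRingEnd ℂ (g i₀) *
          (Complex.exp ((lam i₀ * t : ℝ) * Complex.I) - g i₀) := by
        rw [mul_sub, mul_comm _ (g i₀), Complex.mul_conj, Complex.normSq_eq_norm_sq, hg]
        simp [hz]
      rw [this, norm_mul, RCLike.norm_conj, hg, one_mul]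
    have h4 : ∀ i, ‖z i + 1‖ ^ 2 ≤ 4 := fun i => by
      have := Complex.norm_one_add_sq_le (hz1 i) le_rfl (norm_nonneg _)
      rw [add_comm]; linarith
    have h4' : ‖z i₀ + 1‖ ^ 2 ≤ r * 4 := by
      have := Complex.norm_one_add_sq_le (hz1 i₀) hε.le hz2
      rw [add_comm, hr]; linarith
    have hr0 : 0 ≤ r * 4 := (sq_nonneg _).trans h4'
    rw [norm_prod, ← Finset.mul_prod_erase _ _ (Finset.mem_univ i₀)]
    simp only [norm_pow, pow_mul]
    calc (‖z i₀ + 1‖ ^ 2) ^ p * ∏ i ∈ Finset.univ.erase i₀, (‖z i + 1‖ ^ 2) ^ p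
        ≤ (r * 4) ^ p * ∏ i ∈ Finset.univ.erase i₀, (4 : ℝ) ^ p := by
          gcongr
          exact h4 _
      _ = r ^ p * ∏ i : ι, (4 : ℝ) ^ p := by
          rw [← Finset.mul_prod_erase Finset.univ (fun _ => (4 : ℝ) ^ p) (Finset.mem_univ i₀),
            mul_pow, mul_assoc]
      _ = r ^ p * (4 ^ p) ^ N := by simp [hN]
  -- The coefficient at `k = (p, …, p)` has modulus `centralBinom p ^ N`; independence of `lam`
  -- isolates its frequency. Since `4^p ≤ p * centralBinom p`, this beats exponential decay of
  -- `r^p`.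
  have hcoef : ∀ p : ℕ, ((p.centralBinom : ℝ)) ^ N ≤ r ^ p * (4 ^ p) ^ N := by
    intro p
    have := norm_coeff_le_of_trigPoly_bounded
      (Fintype.piFinset fun _ : ι => Finset.range (2 * p + 1))
      (fun k => ∏ i, (starRingEnd ℂ (g i) ^ (k i) * ((2 * p).choose (k i) : ℂ)))
      (fun k => ∑ i, (k i : ℝ) * lam i) (r ^ p * (4 ^ p) ^ N) (fun _ => p)
      (by simp; omega) ?_ ?_
    · refine le_trans (le_of_eq ?_) this
      simp [norm_prod, hg, hN, Nat.centralBinom]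
    · intro k _ hk heq
      apply hk
      have h := hlam (fun i => (k i : ℤ) - p) (by
        push_cast
        simp only [sub_mul, Finset.sum_sub_distrib]
        simpa [sub_eq_zero] using heq)
      funext i
      have := congrFun h i
      simp only [Pi.zero_apply] at this
      omega
    · intro t ht
      refine le_trans (le_of_eq ?_) (hbound t ht p)
      congr 1
      simp only [add_pow, one_pow, mul_one]
      rw [Finset.prod_univ_sum]
      refine Finset.sum_congr rfl fun k _ => ?_
      rw [Finset.sum_mul, Complex.ofReal_sum, Finset.sum_mul, Complex.exp_sum,
        ← Finset.prod_mul_distrib]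
      refine Finset.prod_congr rfl fun i _ => ?_
      rw [mul_pow, ← Complex.exp_nat_mul, mul_right_comm]
      congr 3
      push_cast; ring
  have hr1 : r < 1 := by rw [hr]; nlinarith [pow_pos hε 2]
  have hr0 : 0 ≤ r := by
    have := hcoef 1
    have h2 : (0 : ℝ) < ((1 : ℕ).centralBinom : ℝ) ^ N := by
      have := Nat.centralBinom_pos 1
      positivity
    by_contra! hneg
    have : r ^ 1 * ((4 : ℝ) ^ 1) ^ N < 0 := by
      rw [pow_one]; exact mul_neg_of_neg_of_pos hneg (by positivity)
    linarith
  have hlim := tendsto_pow_const_mul_const_pow_of_lt_one N hr0 hr1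
  have hev := (hlim.eventually (gt_mem_nhds (zero_lt_one))).and (Filter.eventually_ge_atTop 4)
  obtain ⟨p, hp1, hp4⟩ := hev.exists
  have h1 : ((4 : ℝ) ^ p) ≤ p * p.centralBinom := by
    exact_mod_cast (Nat.four_pow_lt_mul_centralBinom p hp4).le
  have h2 : ((4 : ℝ) ^ p) ^ N ≤ (p : ℝ) ^ N * r ^ p * (4 ^ p) ^ N := by
    calc ((4 : ℝ) ^ p) ^ N ≤ (p * p.centralBinom) ^ N := by gcongr
      _ = (p : ℝ) ^ N * (p.centralBinom : ℝ) ^ N := by rw [mul_pow]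
      _ ≤ (p : ℝ) ^ N * (r ^ p * (4 ^ p) ^ N) := by gcongr; exact hcoef p
      _ = _ := by ring
  have h3 : (0 : ℝ) < (4 ^ p) ^ N := by positivity
  nlinarith

/-! ### Cosine eigenvectors of the path Laplacian -/

theorem Real.sum_cos_add_two_pi_mul_div_eq_zero {q : ℕ} {k : ℤ} (hk : ¬ (q : ℤ) ∣ k)
    (x : ℝ) : ∑ j ∈ Finset.range q, Real.cos (x + 2 * Real.pi * k * j / q) = 0 := by
  rcases Nat.eq_zero_or_pos q with rfl | hq
  · simp
  have hq0 : (q : ℂ) ≠ 0 := by exact_mod_cast hq.ne'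
  set ω : ℂ := Complex.exp (2 * Real.pi * Complex.I * k / q) with hω
  have h1 : ω ^ q = 1 := by
    rw [hω, ← Complex.exp_nat_mul, Complex.exp_eq_one_iff]
    exact ⟨k, by field_simp⟩
  have h2 : ω ≠ 1 := by
    intro h
    obtain ⟨m, hm⟩ := Complex.exp_eq_one_iff.mp h
    apply hk
    refine ⟨m, ?_⟩
    have hpi : (2 * Real.pi * Complex.I : ℂ) ≠ 0 := Complex.two_pi_I_ne_zero
    have : (k : ℂ) = q * m := by
      field_simp at hm
      have h3 : (2 * Real.pi * Complex.I : ℂ) * k = (2 * Real.pi * Complex.I) * (q * m) := by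
        linear_combination (2 * Real.pi * Complex.I : ℂ) * hm
      exact mul_left_cancel₀ hpi h3
    exact_mod_cast this
  have h3 : ∑ j ∈ Finset.range q, ω ^ j = 0 := by
    have := mul_neg_geom_sum ω q
    rw [h1, sub_self] at this
    exact (mul_eq_zero.mp this).resolve_left (sub_ne_zero.mpr h2.symm)
  have h4 : ∀ j : ℕ, Real.cos (x + 2 * Real.pi * k * j / q) =
      (Complex.exp (x * Complex.I) * ω ^ j).re := by
    intro j
    rw [hω, ← Complex.exp_nat_mul, ← Complex.exp_add, ← Complex.exp_ofReal_mul_I_re]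
    congr 2
    push_cast; ring
  simp_rw [h4]
  rw [← Complex.re_sum, ← Finset.mul_sum, h3, mul_zero, Complex.zero_re]

/-- The `r`-th cosine vector, an eigenvector of the Laplacian of the path on `n` vertices. -/
noncomputable def cosVec (n r a : ℕ) : ℝ := Real.cos (Real.pi * r * (a + 1 / 2) / n)

/-- The `r`-th eigenvalue of the Laplacian of the path on `n` vertices. -/
noncomputable def pathEigenvalue (n r : ℕ) : ℝ := 2 - 2 * Real.cos (Real.pi * r / n)

/-- Over a full period `2n`, the indices `r` and `2n - r` give the same eigenvector up to sign and
`r = n` gives zero. This makes the normalisation uniform, with no special weight at `r = 0`. -/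
theorem sum_cosVec_mul_cosVec {n a b : ℕ} (ha : a < n) (hb : b < n) :
    ∑ r ∈ Finset.range (2 * n), cosVec n r a * cosVec n r b = if a = b then (n : ℝ) else 0 := by
  have hn0 : (n : ℝ) ≠ 0 := by exact_mod_cast (by omega : n ≠ 0)
  have h1 : ∀ r : ℕ, cosVec n r a * cosVec n r b =
      (1 / 2) * Real.cos (0 + 2 * Real.pi * ((a + b + 1 : ℤ) : ℝ) * r / (2 * n : ℕ)) +
      (1 / 2) * Real.cos (0 + 2 * Real.pi * ((a - b : ℤ) : ℝ) * r / (2 * n : ℕ)) := by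
    intro r
    have e1 : 0 + 2 * Real.pi * ((a + b + 1 : ℤ) : ℝ) * r / (2 * n : ℕ) =
        Real.pi * r * (a + 1 / 2) / n + Real.pi * r * (b + 1 / 2) / n := by
      push_cast; field_simp; ring
    have e2 : 0 + 2 * Real.pi * ((a - b : ℤ) : ℝ) * r / (2 * n : ℕ) =
        Real.pi * r * (a + 1 / 2) / n - Real.pi * r * (b + 1 / 2) / n := by
      push_cast; field_simp; ring
    rw [e1, e2, Real.cos_add, Real.cos_sub, cosVec, cosVec]
    ring
  simp_rw [h1]
  rw [Finset.sum_add_distrib, ← Finset.mul_sum, ← Finset.mul_sum,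
    Real.sum_cos_add_two_pi_mul_div_eq_zero]
  · split_ifs with hab
    · subst hab
      simp
    · rw [Real.sum_cos_add_two_pi_mul_div_eq_zero]
      · simp
      · intro h
        have := Int.eq_zero_of_abs_lt_dvd h (by rw [abs_lt]; push_cast; constructor <;> omega)
        omega
  · intro h
    have := Int.le_of_dvd (by omega) h
    push_cast at this
    omega

theorem cosVec_self (n a : ℕ) (hn : n ≠ 0) : cosVec n n a = 0 := by
  have hn0 : (n : ℝ) ≠ 0 := by exact_mod_cast hn
  rw [cosVec, Real.cos_eq_zero_iff]
  exact ⟨a, by push_cast; field_simp⟩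

theorem cosVec_zero_ne_zero {n r : ℕ} (hr : r < 2 * n) (hrn : r ≠ n) : cosVec n r 0 ≠ 0 := by
  have hn0 : (n : ℝ) ≠ 0 := by exact_mod_cast (by omega : n ≠ 0)
  rw [cosVec, Ne, Real.cos_eq_zero_iff]
  rintro ⟨k, hk⟩
  push_cast at hk
  field_simp at hk
  have h1 : (r : ℤ) = n * (2 * k + 1) := by
    have : (r : ℝ) = n * (2 * k + 1) := by linarith
    exact_mod_cast this
  have hk0 : k = 0 := by
    have : 0 < (n : ℤ) := by omega
    have h2 : 2 * k + 1 < 2 := by nlinarith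
    have h3 : -1 < 2 * k + 1 := by nlinarith
    omega
  subst hk0
  omega

theorem cosVec_rev {n a : ℕ} (r : ℕ) (ha : a < n) :
    cosVec n r (n - 1 - a) = (-1) ^ r * cosVec n r a := by
  have hn0 : (n : ℝ) ≠ 0 := by exact_mod_cast (by omega : n ≠ 0)
  have h : ((n - 1 - a : ℕ) : ℝ) = n - 1 - a := by
    rw [Nat.cast_sub (by omega), Nat.cast_sub (by omega)]; simp
  rw [cosVec, cosVec, h, ← Real.cos_nat_mul_pi_sub]
  congr 1
  field_simp; ring

theorem cosVec_succ_succ_add {n r a : ℕ} :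
    cosVec n r (a + 2) + cosVec n r a = (2 - pathEigenvalue n r) * cosVec n r (a + 1) := by
  have e1 : Real.pi * r * ((a + 2 : ℕ) + 1 / 2) / n =
      Real.pi * r * ((a + 1 : ℕ) + 1 / 2) / n + Real.pi * r / n := by push_cast; ring
  have e2 : Real.pi * r * (a + 1 / 2) / n =
      Real.pi * r * ((a + 1 : ℕ) + 1 / 2) / n - Real.pi * r / n := by push_cast; ring
  rw [cosVec, cosVec, cosVec, pathEigenvalue, e1, e2, Real.cos_add, Real.cos_sub]
  ring

theorem cosVec_zero_sub_one {n r : ℕ} :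
    cosVec n r 0 - cosVec n r 1 = pathEigenvalue n r * cosVec n r 0 := by
  have e1 : Real.pi * r * ((1 : ℕ) + 1 / 2) / n =
      Real.pi * r * ((0 : ℕ) + 1 / 2) / n + Real.pi * r / n := by push_cast; ring
  have e2 : Real.pi * r / n = 2 * (Real.pi * r * ((0 : ℕ) + 1 / 2) / n) := by push_cast; ring
  rw [cosVec, cosVec, pathEigenvalue, e1, Real.cos_add, e2, Real.sin_two_mul, Real.cos_two_mul]
  have := Real.sin_sq_add_cos_sq (Real.pi * r * ((0 : ℕ) + 1 / 2) / n)
  linear_combination (2 * Real.cos (Real.pi * r * ((0 : ℕ) + 1 / 2) / n)) * this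

/-- Neumann condition: a ghost vertex `n` repeats the last value, so the last vertex obeys the
interior recurrence. -/
theorem cosVec_last {n r : ℕ} (hn : 1 ≤ n) : cosVec n r n = cosVec n r (n - 1) := by
  have hn0 : (n : ℝ) ≠ 0 := by exact_mod_cast (by omega : n ≠ 0)
  have e1 : Real.pi * r * (n + 1 / 2) / n = r * Real.pi + Real.pi * r / (2 * n) := by
    field_simp
  have e2 : Real.pi * r * ((n - 1 : ℕ) + 1 / 2) / n = r * Real.pi - Real.pi * r / (2 * n) := by
    rw [Nat.cast_sub hn]; push_cast; field_simp; ring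
  rw [cosVec, cosVec, e1, e2, Real.cos_add, Real.cos_sub, Real.sin_nat_mul_pi]
  ring

open scoped Matrix in
theorem hamiltonianXYZ_mulVec_cosVec (n r : ℕ) :
    hamiltonianXYZ (SimpleGraph.pathGraph n) *ᵥ (fun a : Fin n => cosVec n r a) =
      pathEigenvalue n r • fun a : Fin n => cosVec n r a := by
  classical
  funext a
  rw [hamiltonianXYZ, SimpleGraph.lapMatrix_mulVec_apply, ← SimpleGraph.card_neighborFinset_eq_degree,
    ← nsmul_eq_mul, ← Finset.sum_const, ← Finset.sum_sub_distrib,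
    SimpleGraph.neighborFinset_eq_filter, Finset.sum_filter]
  have h1 : ∀ b : Fin n, (if (SimpleGraph.pathGraph n).Adj a b then
      cosVec n r a - cosVec n r b else 0) =
      (if (b : ℕ) = a + 1 then cosVec n r a - cosVec n r b else 0) +
      (if (b : ℕ) + 1 = a then cosVec n r a - cosVec n r b else 0) := by
    intro b
    simp only [SimpleGraph.pathGraph_adj]
    split_ifs <;> first | omega | simp
  simp_rw [h1]
  rw [Finset.sum_add_distrib]
  have h2 : ∑ b : Fin n, (if (b : ℕ) = a + 1 then cosVec n r a - cosVec n r b else 0) =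
      cosVec n r a - cosVec n r (a + 1) := by
    by_cases h : (a : ℕ) + 1 < n
    · rw [Finset.sum_eq_single ⟨a + 1, h⟩]
      · simp
      · intro b _ hb
        rw [if_neg]
        exact fun hh => hb (Fin.ext hh)
      · simp
    · have ha : (a : ℕ) + 1 = n := by omega
      rw [Finset.sum_eq_zero, ha, cosVec_last (by omega), show n - 1 = (a : ℕ) by omega, sub_self]
      · intro b _
        rw [if_neg (by omega)]
  have h3 : ∑ b : Fin n, (if (b : ℕ) + 1 = a then cosVec n r a - cosVec n r b else 0) =
      if (a : ℕ) = 0 then 0 else cosVec n r a - cosVec n r (a - 1) := by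
    split_ifs with h
    · refine Finset.sum_eq_zero fun b _ => ?_
      rw [if_neg (by omega)]
    · rw [Finset.sum_eq_single ⟨a - 1, by omega⟩]
      · rw [if_pos]
        simp; omega
      · intro b _ hb
        rw [if_neg]
        exact fun hh => hb (Fin.ext (by simp; omega))
      · simp
  rw [h2, h3, Pi.smul_apply, smul_eq_mul]
  rcases Nat.eq_zero_or_pos (a : ℕ) with h | h
  · rw [if_pos h, h, add_zero]
    exact cosVec_zero_sub_one
  · rw [if_neg h.ne']
    obtain ⟨c, hc⟩ := Nat.exists_eq_add_of_le' h
    rw [hc, Nat.add_sub_cancel]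
    have := cosVec_succ_succ_add (n := n) (r := r) (a := c)
    linear_combination -this

-- Spectral form of the transition matrix

attribute [local instance] Matrix.linftyOpNormedRing Matrix.linftyOpNormedAlgebra in
open scoped Matrix in
theorem Matrix.exp_mulVec_of_eigenvector {V : Type*} [Fintype V] [DecidableEq V]
    {A : Matrix V V ℂ} {v : V → ℂ} {θ : ℂ} (h : A *ᵥ v = θ • v) :
    NormedSpace.exp A *ᵥ v = Complex.exp θ • v := by
  have hpow : ∀ k : ℕ, A ^ k *ᵥ v = θ ^ k • v := by
    intro k
    induction k with
    | zero => simp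
    | succ k ih => rw [pow_succ', ← Matrix.mulVec_mulVec, ih, Matrix.mulVec_smul, h, smul_smul,
        pow_succ]
  have h1 := NormedSpace.exp_series_hasSum_exp' (𝕂 := ℂ) A
  let φ : Matrix V V ℂ →ₗ[ℂ] (V → ℂ) :=
    { toFun := fun B => B *ᵥ v
      map_add' := fun B C => Matrix.add_mulVec B C v
      map_smul' := fun c B => Matrix.smul_mulVec c B v }
  have hφ : Continuous φ := continuous_id.matrix_mulVec continuous_const
  have h2 := h1.map φ hφ
  have h3 := (NormedSpace.exp_series_hasSum_exp' (𝕂 := ℂ) θ).smul_const v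
  rw [← Complex.exp_eq_exp_ℂ] at h3
  refine h2.unique ?_
  convert h3 using 1
  funext k
  change φ ((k.factorial : ℂ)⁻¹ • A ^ k) = _
  rw [map_smul, show φ (A ^ k) = A ^ k *ᵥ v from rfl, hpow, smul_smul, smul_eq_mul]

open scoped Matrix in
theorem transitionMatrix_pathGraph_apply {n : ℕ} (t : ℝ) (a b : Fin n) :
    transitionMatrix (hamiltonianXYZ (SimpleGraph.pathGraph n)) t a b =
      (1 / n) * ∑ r ∈ Finset.range (2 * n), ((cosVec n r a * cosVec n r b : ℝ) : ℂ) *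
        Complex.exp ((pathEigenvalue n r * t : ℝ) * Complex.I) := by
  have hn0 : (n : ℂ) ≠ 0 := by exact_mod_cast (by have := a.2; omega : n ≠ 0)
  set H := hamiltonianXYZ (SimpleGraph.pathGraph n)
  have heig : ∀ r : ℕ, transitionMatrix H t *ᵥ (fun c : Fin n => (cosVec n r c : ℂ)) =
      Complex.exp ((pathEigenvalue n r * t : ℝ) * Complex.I) •
        fun c : Fin n => (cosVec n r c : ℂ) := by
    intro r
    refine Matrix.exp_mulVec_of_eigenvector ?_
    have h1 := hamiltonianXYZ_mulVec_cosVec n r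
    have h2 : H.map Complex.ofReal *ᵥ (fun c : Fin n => (cosVec n r c : ℂ)) =
        (pathEigenvalue n r : ℂ) • fun c : Fin n => (cosVec n r c : ℂ) := by
      funext c
      have h3 := congrArg Complex.ofReal (congrFun h1 c)
      simp only [Matrix.mulVec, dotProduct, Pi.smul_apply, smul_eq_mul, Complex.ofReal_sum,
        Complex.ofReal_mul] at h3
      simpa [Matrix.mulVec, dotProduct] using h3
    rw [Matrix.smul_mulVec, h2, smul_smul]
    congr 1
    push_cast; ring
  have hdelta : (Pi.single b 1 : Fin n → ℂ) = (1 / n : ℂ) •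
      ∑ r ∈ Finset.range (2 * n), (cosVec n r b : ℂ) • fun c : Fin n => (cosVec n r c : ℂ) := by
    funext c
    have h := congrArg Complex.ofReal (sum_cosVec_mul_cosVec b.2 c.2)
    rw [Complex.ofReal_sum] at h
    simp only [Pi.smul_apply, Finset.sum_apply, smul_eq_mul, Complex.ofReal_mul] at h ⊢
    rw [h]
    by_cases hbc : b = c
    · subst hbc; simp [hn0]
    · rw [Pi.single_eq_of_ne (Ne.symm hbc), if_neg (fun hh => hbc (Fin.ext hh))]; simp
  have h1 : transitionMatrix H t a b = (transitionMatrix H t *ᵥ Pi.single b 1) a := by simp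
  rw [h1, hdelta, Matrix.mulVec_smul, Matrix.mulVec_sum]
  simp only [Matrix.mulVec_smul, heig, Pi.smul_apply, Finset.sum_apply, smul_eq_mul]
  congr 1
  refine Finset.sum_congr rfl fun r _ => ?_
  push_cast; ring

/-! ### The orbit closure in the torus -/

/-- The forward orbit of the one-parameter flow with frequencies `2 cos (π s / n)`. -/
def cosOrbit (n : ℕ) : Set (ℕ → ℂ) :=
  {z | ∃ τ : ℝ, 0 < τ ∧
    z = fun s : ℕ => Complex.exp ((2 * Real.cos (Real.pi * s / n) * τ : ℝ) * Complex.I)}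

/-- The transition amplitude between `a` and `b`, up to a phase, as a function of the torus point
`z`. -/
noncomputable def pathAmplitude (n a b : ℕ) (z : ℕ → ℂ) : ℂ :=
  (1 / n) * ∑ r ∈ Finset.range (2 * n), ((cosVec n r a * cosVec n r b : ℝ) : ℂ) * z r

theorem continuous_pathAmplitude (n a b : ℕ) : Continuous (pathAmplitude n a b) := by
  unfold pathAmplitude
  fun_prop

theorem norm_transitionMatrix_pathGraph {n : ℕ} (t : ℝ) (a b : Fin n) :
    ‖transitionMatrix (hamiltonianXYZ (SimpleGraph.pathGraph n)) t a b‖ =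
      ‖pathAmplitude n a b
        (fun s => Complex.exp ((2 * Real.cos (Real.pi * s / n) * t : ℝ) * Complex.I))‖ := by
  rw [transitionMatrix_pathGraph_apply, ← RCLike.norm_conj (pathAmplitude n a b _), pathAmplitude]
  have h : ∀ r : ℕ, Complex.exp ((pathEigenvalue n r * t : ℝ) * Complex.I) =
      Complex.exp ((2 * t : ℝ) * Complex.I) * (starRingEnd ℂ)
        (Complex.exp ((2 * Real.cos (Real.pi * r / n) * t : ℝ) * Complex.I)) := by
    intro r
    rw [← Complex.exp_conj, ← Complex.exp_add, map_mul, Complex.conj_I, Complex.conj_ofReal,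
      pathEigenvalue]
    congr 1
    push_cast; ring
  have h2 : (1 / n : ℂ) * ∑ r ∈ Finset.range (2 * n), ((cosVec n r a * cosVec n r b : ℝ) : ℂ) *
        Complex.exp ((pathEigenvalue n r * t : ℝ) * Complex.I) =
      Complex.exp ((2 * t : ℝ) * Complex.I) * (starRingEnd ℂ) ((1 / n : ℂ) *
        ∑ r ∈ Finset.range (2 * n), ((cosVec n r a * cosVec n r b : ℝ) : ℂ) *
        Complex.exp ((2 * Real.cos (Real.pi * r / n) * t : ℝ) * Complex.I)) := by
    rw [map_mul, map_sum, mul_left_comm, Finset.mul_sum (Finset.range (2 * n)) _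
      (Complex.exp ((2 * t : ℝ) * Complex.I))]
    congr 1
    · simp
    · refine Finset.sum_congr rfl fun r _ => ?_
      rw [h, map_mul, Complex.conj_ofReal]
      ring
  rw [h2, norm_mul, Complex.norm_exp_ofReal_mul_I, one_mul]

theorem norm_eq_one_of_mem_closure_cosOrbit {n : ℕ} {z : ℕ → ℂ} (hz : z ∈ closure (cosOrbit n))
    (s : ℕ) : ‖z s‖ = 1 := by
  have hcl : IsClosed {z : ℕ → ℂ | ‖z s‖ = 1} :=
    isClosed_eq (by fun_prop) continuous_const
  refine closure_minimal ?_ hcl hz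
  rintro _ ⟨τ, -, rfl⟩
  exact Complex.norm_exp_ofReal_mul_I _

theorem isCompact_closure_cosOrbit (n : ℕ) : IsCompact (closure (cosOrbit n)) := by
  have h : IsCompact (Set.univ.pi fun _ : ℕ => Metric.closedBall (0 : ℂ) 1) :=
    isCompact_univ_pi fun _ => isCompact_closedBall _ _
  refine h.of_isClosed_subset isClosed_closure fun z hz s _ => ?_
  rw [mem_closedBall_zero_iff]
  exact (norm_eq_one_of_mem_closure_cosOrbit hz s).le

/-- The relation holds along the orbit and is a closed condition. -/
theorem prod_eq_one_of_mem_closure_cosOrbit {n : ℕ} {z : ℕ → ℂ} (hz : z ∈ closure (cosOrbit n))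
    (p : ℕ) (f : ℕ → ℕ) (hf : ∑ j ∈ Finset.range p, Real.cos (Real.pi * f j / n) = 0) :
    ∏ j ∈ Finset.range p, z (f j) = 1 := by
  have hcl : IsClosed {z : ℕ → ℂ | ∏ j ∈ Finset.range p, z (f j) = 1} :=
    isClosed_eq (by fun_prop) continuous_const
  refine closure_minimal ?_ hcl hz
  rintro _ ⟨τ, -, rfl⟩
  rw [Set.mem_ofPred_eq, ← Complex.exp_sum, ← Finset.sum_mul, ← Complex.ofReal_sum,
    ← Finset.sum_mul, ← Finset.mul_sum, hf]
  simp

theorem apply_eq_apply_of_mem_closure_cosOrbit {n : ℕ} {z : ℕ → ℂ}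
    (hz : z ∈ closure (cosOrbit n)) {r s : ℕ}
    (h : Real.cos (Real.pi * r / n) = Real.cos (Real.pi * s / n)) : z r = z s := by
  have hcl : IsClosed {z : ℕ → ℂ | z r = z s} := isClosed_eq (by fun_prop) (by fun_prop)
  refine closure_minimal ?_ hcl hz
  rintro _ ⟨τ, -, rfl⟩
  simp only [Set.mem_ofPred_eq, h]

theorem mul_eq_one_of_mem_closure_cosOrbit {n : ℕ} (hn : n ≠ 0) {z : ℕ → ℂ}
    (hz : z ∈ closure (cosOrbit n)) {s : ℕ} (hs : s ≤ n) : z s * z (n - s) = 1 := by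
  have hn0 : (n : ℝ) ≠ 0 := by exact_mod_cast hn
  have := prod_eq_one_of_mem_closure_cosOrbit hz 2 (fun j => if j = 0 then s else n - s) (by
    simp only [Finset.sum_range_succ, Finset.sum_range_zero, zero_add, if_true, one_ne_zero,
      if_false]
    rw [Nat.cast_sub hs, show Real.pi * ((n : ℝ) - s) / n = Real.pi - Real.pi * s / n by
      field_simp, Real.cos_pi_sub, add_neg_cancel])
  simpa [Finset.prod_range_succ] using this

theorem apply_two_mul_sub_of_mem_closure_cosOrbit {n : ℕ} (hn : n ≠ 0) {z : ℕ → ℂ}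
    (hz : z ∈ closure (cosOrbit n)) {s : ℕ} (hs : s ≤ 2 * n) : z (2 * n - s) = z s := by
  have hn0 : (n : ℝ) ≠ 0 := by exact_mod_cast hn
  refine apply_eq_apply_of_mem_closure_cosOrbit hz ?_
  rw [Nat.cast_sub hs]
  push_cast
  rw [show Real.pi * (2 * (n : ℝ) - s) / n = 2 * Real.pi - Real.pi * s / n by field_simp,
    Real.cos_two_pi_sub]

theorem prettyGoodStateTransfer_pathGraph_iff {n : ℕ} (a b : Fin n) :
    PrettyGoodStateTransfer (hamiltonianXYZ (SimpleGraph.pathGraph n)) a b ↔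
      ∃ z ∈ closure (cosOrbit n), 1 ≤ ‖pathAmplitude n a b z‖ := by
  constructor
  · intro h
    have hne : (closure (cosOrbit n)).Nonempty :=
      ⟨_, subset_closure ⟨1, one_pos, rfl⟩⟩
    obtain ⟨z, hz, hmax⟩ := (isCompact_closure_cosOrbit n).exists_isMaxOn hne
      (continuous_pathAmplitude n a b).norm.continuousOn
    refine ⟨z, hz, le_of_forall_pos_sub_le fun ε hε => ?_⟩
    obtain ⟨τ, hτ, hlt⟩ := h ε hε
    rw [norm_transitionMatrix_pathGraph] at hlt
    exact hlt.le.trans (hmax (subset_closure ⟨τ, hτ, rfl⟩))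
  · rintro ⟨z, hz, h1⟩ ε hε
    have ho : IsOpen {w | 1 - ε < ‖pathAmplitude n a b w‖} :=
      isOpen_lt continuous_const (continuous_pathAmplitude n a b).norm
    obtain ⟨_, hw, τ, hτ, rfl⟩ := mem_closure_iff.mp hz _ ho (by
      rw [Set.mem_ofPred_eq]; linarith)
    refine ⟨τ, hτ, ?_⟩
    rw [norm_transitionMatrix_pathGraph]
    exact hw

/-! ### Mirror vertices and the equality case -/

theorem pathAmplitude_rev {n a : ℕ} (ha : a < n) (z : ℕ → ℂ) :
    pathAmplitude n a (n - 1 - a) z = ∑ r ∈ Finset.range (2 * n),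
      ((cosVec n r a ^ 2 / n : ℝ) : ℂ) * ((-1) ^ r * z r) := by
  rw [pathAmplitude, Finset.mul_sum]
  refine Finset.sum_congr rfl fun r _ => ?_
  rw [cosVec_rev r ha]
  push_cast; ring

theorem sum_cosVec_sq_div {n a : ℕ} (ha : a < n) :
    ∑ r ∈ Finset.range (2 * n), cosVec n r a ^ 2 / n = 1 := by
  have hn0 : (n : ℝ) ≠ 0 := by exact_mod_cast (by omega : n ≠ 0)
  have := sum_cosVec_mul_cosVec ha ha
  rw [if_pos rfl] at this
  simp_rw [sq]
  rw [← Finset.sum_div, this, div_self hn0]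

theorem norm_pathAmplitude_rev_of_alternating {n a : ℕ} (ha : a < n) {z : ℕ → ℂ} {c : ℂ}
    (hc : ‖c‖ = 1) (h : ∀ r < 2 * n, r ≠ n → z r = (-1) ^ r * c) :
    ‖pathAmplitude n a (n - 1 - a) z‖ = 1 := by
  have h1 : pathAmplitude n a (n - 1 - a) z = c := by
    rw [pathAmplitude_rev ha]
    have h2 : ∀ r ∈ Finset.range (2 * n), ((cosVec n r a ^ 2 / n : ℝ) : ℂ) * ((-1) ^ r * z r) =
        ((cosVec n r a ^ 2 / n : ℝ) : ℂ) * c := by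
      intro r hr
      rw [Finset.mem_range] at hr
      by_cases hrn : r = n
      · subst hrn
        simp [cosVec_self r a (by omega)]
      · rw [h r hr hrn, ← mul_assoc ((-1 : ℂ) ^ r), ← mul_pow]
        simp
    rw [Finset.sum_congr rfl h2, ← Finset.sum_mul, ← Complex.ofReal_sum, sum_cosVec_sq_div ha]
    simp
  rw [h1, hc]

/-- A convex combination of unit complex numbers has norm at least one only if all those with
nonzero weight coincide. -/
theorem exists_unit_eq_of_one_le_norm_sum {ι : Type*} (S : Finset ι) (w : ι → ℝ) (y : ι → ℂ)
    (hw : ∀ i ∈ S, 0 ≤ w i) (hsum : ∑ i ∈ S, w i = 1) (hy : ∀ i, ‖y i‖ = 1)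
    (h : 1 ≤ ‖∑ i ∈ S, (w i : ℂ) * y i‖) : ∃ c : ℂ, ‖c‖ = 1 ∧ ∀ i ∈ S, w i ≠ 0 → y i = c := by
  set c := ∑ i ∈ S, (w i : ℂ) * y i with hc
  have hc1 : ‖c‖ = 1 := by
    refine le_antisymm ?_ h
    calc ‖c‖ ≤ ∑ i ∈ S, ‖(w i : ℂ) * y i‖ := norm_sum_le _ _
      _ = ∑ i ∈ S, w i := Finset.sum_congr rfl fun i hi => by
          rw [norm_mul, hy, mul_one, Complex.norm_real, Real.norm_of_nonneg (hw i hi)]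
      _ = 1 := hsum
  refine ⟨c, hc1, ?_⟩
  have hterm : ∀ i, ‖y i - c‖ ^ 2 = 2 - 2 * inner ℝ (y i) c := by
    intro i
    rw [norm_sub_sq_real, hy, hc1]
    ring
  -- The weighted variance about the mean `c` is `1 - ‖c‖^2 = 0`.
  have hzero : ∑ i ∈ S, w i * ‖y i - c‖ ^ 2 = 0 := by
    have h1 : ∑ i ∈ S, w i * inner ℝ (y i) c = 1 := by
      have h2 : inner ℝ c c = (1 : ℝ) := by rw [real_inner_self_eq_norm_sq, hc1]; norm_num
      rw [← h2]
      conv_rhs => rw [hc]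
      rw [sum_inner]
      refine Finset.sum_congr rfl fun i _ => ?_
      rw [← Complex.real_smul, real_inner_smul_left]
    simp_rw [hterm, mul_sub]
    rw [Finset.sum_sub_distrib, ← Finset.sum_mul, hsum]
    have : ∑ i ∈ S, w i * (2 * inner ℝ (y i) c) = 2 * ∑ i ∈ S, w i * inner ℝ (y i) c := by
      rw [Finset.mul_sum]
      exact Finset.sum_congr rfl fun i _ => by ring
    rw [this, h1]
    ring
  intro i hi hwi
  have := (Finset.sum_eq_zero_iff_of_nonneg fun i hi =>
    mul_nonneg (hw i hi) (sq_nonneg _)).mp hzero i hi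
  have h3 := (mul_eq_zero.mp this).resolve_left hwi
  exact sub_eq_zero.mp (norm_eq_zero.mp (pow_eq_zero_iff two_ne_zero |>.mp h3))

theorem exists_alternating_of_one_le_norm_pathAmplitude {n : ℕ} (hn : 1 ≤ n) {z : ℕ → ℂ}
    (hz : ∀ s, ‖z s‖ = 1) (h : 1 ≤ ‖pathAmplitude n 0 (n - 1) z‖) :
    ∃ c : ℂ, ∀ r < 2 * n, r ≠ n → z r = (-1) ^ r * c := by
  have hn0 : (n : ℝ) ≠ 0 := by exact_mod_cast (by omega : n ≠ 0)
  have h1 := pathAmplitude_rev (a := 0) hn z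
  rw [Nat.sub_zero] at h1
  rw [h1] at h
  obtain ⟨c, -, hc⟩ := exists_unit_eq_of_one_le_norm_sum _ (fun r => cosVec n r 0 ^ 2 / n)
    (fun r => (-1) ^ r * z r) (fun _ _ => by positivity) (sum_cosVec_sq_div hn)
    (fun r => by simp [hz]) h
  refine ⟨c, fun r hr hrn => ?_⟩
  rw [← hc r (Finset.mem_range.mpr hr)
    (div_ne_zero (pow_ne_zero 2 (cosVec_zero_ne_zero hr hrn)) hn0), ← mul_assoc, ← mul_pow]
  simp

/-! ### Necessity: no odd factor -/

theorem sum_cos_progression_eq_zero {m p : ℕ} (hm : m ≠ 0) (hp : 1 < p) (e : ℕ) :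
    ∑ j ∈ Finset.range p, Real.cos (Real.pi * (e + 2 * m * j : ℕ) / (m * p : ℕ)) = 0 := by
  have hm0 : (m : ℝ) ≠ 0 := by exact_mod_cast hm
  have hp0 : (p : ℝ) ≠ 0 := by exact_mod_cast (by omega : p ≠ 0)
  rw [← Real.sum_cos_add_two_pi_mul_div_eq_zero (q := p) (k := 1)
    (fun h => by have := Int.le_of_dvd one_pos h; omega) (Real.pi * e / (m * p))]
  refine Finset.sum_congr rfl fun j _ => ?_
  congr 1
  push_cast
  field_simp

theorem exists_eq_two_pow_of_alternating_mem_closure_cosOrbit {n : ℕ} (hn : 1 ≤ n) {z : ℕ → ℂ}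
    (hz : z ∈ closure (cosOrbit n)) {c : ℂ} (hc : ∀ r < 2 * n, r ≠ n → z r = (-1) ^ r * c) :
    ∃ k : ℕ, n = 2 ^ k := by
  obtain ⟨k, p, hp, hnp⟩ := Nat.exists_eq_two_pow_mul_odd (n := n) (by omega)
  refine ⟨k, ?_⟩
  by_contra hne
  have hp1 : 1 < p := by
    rcases Nat.lt_or_ge 1 p with h | h
    · exact h
    · exfalso
      have : p = 1 := by have := hp.pos; omega
      rw [this, mul_one] at hnp
      exact hne hnp
  set m := 2 ^ k with hm
  have hm0 : 0 < m := by positivity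
  -- The even step `2m` keeps the sign `(-1)^e` along the progression; index `n` must be avoided, as
  -- `z n` is unconstrained.
  have hprod : ∀ e : ℕ, e < 2 * m → (∀ j < p, e + 2 * m * j ≠ n) →
      ((-1) ^ e * c) ^ p = 1 := by
    intro e he hj
    have h := prod_eq_one_of_mem_closure_cosOrbit hz p (fun j => e + 2 * m * j) (by
      rw [hnp]; exact sum_cos_progression_eq_zero hm0.ne' hp1 e)
    refine Eq.trans ?_ h
    rw [show ((-1) ^ e * c) ^ p = ∏ _j ∈ Finset.range p, ((-1) ^ e * c) by simp]
    refine Finset.prod_congr rfl fun j hjp => ?_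
    rw [Finset.mem_range] at hjp
    have hlt : e + 2 * m * j < 2 * n := by
      have : m * (j + 1) ≤ m * p := Nat.mul_le_mul_left m hjp
      rw [hnp]; nlinarith
    rw [hc _ hlt (hj j hjp), pow_add, mul_assoc 2 m j, pow_mul (-1 : ℂ) 2, neg_one_sq, one_pow,
      mul_one]
  have h0 : c ^ p = 1 := by
    have := hprod 0 (by omega) (fun j _ h => by
      rw [hnp, zero_add, mul_assoc, mul_left_comm] at h
      have h2 := Nat.eq_of_mul_eq_mul_left hm0 h
      obtain ⟨q, hq⟩ := hp
      omega)
    simpa using this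
  -- For odd `n` the progression from `e = 1` hits `n`, so `z 1 * z (n - 1) = 1` is used instead.
  -- For even `n` its terms are odd and miss `n`.
  rcases Nat.eq_zero_or_pos k with hk | hk
  · have hn' : n = p := by rw [hnp, hm, hk]; simp
    have hmul := mul_eq_one_of_mem_closure_cosOrbit (by omega) hz hn
    have hodd : Odd n := hn' ▸ hp
    rw [hc 1 (by omega) (by omega), hc (n - 1) (by omega) (by omega),
      (Nat.Odd.sub_odd hodd odd_one).neg_one_pow] at hmul
    have hc2 : c ^ 2 = -1 := by linear_combination -hmul
    have h2 : (c ^ 2) ^ p = 1 := by rw [← pow_mul, mul_comm, pow_mul, h0, one_pow]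
    rw [hc2, hp.neg_one_pow] at h2
    norm_num at h2
  · have hme : Even m := by rw [hm]; exact (Nat.even_pow.mpr ⟨even_two, hk.ne'⟩)
    have h1 := hprod 1 (by omega) (fun j _ h => by
      have he : Even n := hnp ▸ hme.mul_right p
      rw [← h] at he
      obtain ⟨q, hq⟩ := he
      rw [mul_assoc] at hq
      omega)
    rw [pow_one, neg_one_mul, hp.neg_pow, h0] at h1
    norm_num at h1

/-! ### Sufficiency: powers of two -/

-- Multiplied by `ζ^h`, with `ζ` a primitive `4h`-th root of unity, a relation becomes a rational
-- polynomial of degree below `2h = φ(4h)` vanishing at `ζ`, hence zero.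
open Polynomial in
theorem eq_zero_of_sum_mul_two_cos_eq_zero {m h : ℕ} (hh : h = 2 ^ m) (c : Fin h → ℤ)
    (hc : ∑ s, (c s : ℝ) * (2 * Real.cos (Real.pi * (s : ℕ) / (2 ^ (m + 1) : ℕ))) = 0) :
    c = 0 := by
  have hh0 : 0 < h := by rw [hh]; positivity
  have hn2 : 2 ^ (m + 2) = 4 * h := by rw [hh]; ring
  have hn1 : 2 ^ (m + 1) = 2 * h := by rw [hh]; ring
  set ζ : ℂ := Complex.exp (2 * Real.pi * Complex.I / (2 ^ (m + 2) : ℕ)) with hζ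
  have hprim : IsPrimitiveRoot ζ (2 ^ (m + 2)) := Complex.isPrimitiveRoot_exp _ (by positivity)
  have hζ0 : ζ ≠ 0 := Complex.exp_ne_zero _
  have hterm : ∀ s < h, ((2 * Real.cos (Real.pi * (s : ℕ) / (2 ^ (m + 1) : ℕ)) : ℝ) : ℂ) * ζ ^ h =
      ζ ^ (h + s) + ζ ^ (h - s) := by
    intro s hs
    have h1 : ((2 * Real.cos (Real.pi * (s : ℕ) / (2 ^ (m + 1) : ℕ)) : ℝ) : ℂ) =
        ζ ^ s + (ζ ^ s)⁻¹ := by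
      rw [hζ, ← Complex.exp_nat_mul, ← Complex.exp_neg, hn2, hn1]
      push_cast
      rw [Complex.two_cos]
      have hh0' : (h : ℂ) ≠ 0 := by exact_mod_cast hh0.ne'
      congr 2 <;> (field_simp; ring)
    rw [h1, add_mul, pow_add, pow_sub₀ _ hζ0 hs.le]
    ring
  set P : ℚ[X] := ∑ s : Fin h, C (c s : ℚ) * (X ^ (h + (s : ℕ)) + X ^ (h - (s : ℕ))) with hP
  have haeval : aeval ζ P = 0 := by
    have h1 := congrArg (fun x : ℝ => (x : ℂ) * ζ ^ h) hc
    simp only [Complex.ofReal_zero, zero_mul, Complex.ofReal_sum, Finset.sum_mul] at h1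
    rw [hP, map_sum, ← h1]
    refine Finset.sum_congr rfl fun s _ => ?_
    rw [Complex.ofReal_mul, mul_assoc, hterm s s.2]
    simp
  have hdeg : P.degree < (2 * h : ℕ) := by
    rw [← mem_degreeLT]
    refine Submodule.sum_mem _ fun s _ => ?_
    have hs := s.2
    rw [← smul_eq_C_mul]
    refine Submodule.smul_mem _ _ (Submodule.add_mem _ ?_ ?_) <;>
      (rw [mem_degreeLT, degree_X_pow]; norm_cast; omega)
  have hP0 : P = 0 := by
    by_contra hne
    have h1 := minpoly.degree_le_of_ne_zero ℚ ζ hne haeval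
    rw [← cyclotomic_eq_minpoly_rat hprim (by positivity), degree_cyclotomic,
      Nat.totient_prime_pow Nat.prime_two (by omega)] at h1
    have h2 : 2 ^ (m + 2 - 1) * (2 - 1) = 2 * h := by
      rw [show m + 2 - 1 = m + 1 by omega, hn1]; omega
    rw [h2] at h1
    exact absurd hdeg (not_lt.mpr h1)
  funext s
  have hcoef : P.coeff (h + s) = c s + if (s : ℕ) = 0 then (c s : ℚ) else 0 := by
    rw [hP, finsetSum_coeff]
    simp only [coeff_C_mul, coeff_add, coeff_X_pow]
    rw [Finset.sum_eq_single s]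
    · have := s.2
      by_cases hs : (s : ℕ) = 0
      · simp [hs]
        ring
      · rw [if_pos rfl, if_neg (by omega), if_neg hs]
        ring
    · intro b _ hb
      have hb' : (b : ℕ) ≠ s := fun hbs => hb (Fin.ext hbs)
      rw [if_neg (by omega), if_neg (by omega)]
      ring
    · simp
  rw [hP0, coeff_zero] at hcoef
  have : (c s : ℚ) = 0 := by
    split_ifs at hcoef <;> linarith
  exact_mod_cast this

theorem exists_alternating_mem_closure_cosOrbit (k : ℕ) :
    ∃ z ∈ closure (cosOrbit (2 ^ k)), ∃ c : ℂ, ‖c‖ = 1 ∧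
      ∀ r < 2 * 2 ^ k, r ≠ 2 ^ k → z r = (-1) ^ r * c := by
  rcases k with _ | m
  · have hmem : (fun s : ℕ => Complex.exp ((2 * Real.cos (Real.pi * s / (2 ^ 0 : ℕ)) * 1 : ℝ) *
        Complex.I)) ∈ cosOrbit (2 ^ 0) := ⟨1, one_pos, rfl⟩
    refine ⟨_, subset_closure hmem, _,
      norm_eq_one_of_mem_closure_cosOrbit (subset_closure hmem) 0, fun r hr hr1 => ?_⟩
    have : r = 0 := by rw [pow_zero] at hr hr1; omega
    subst this
    simp
  set h := 2 ^ m with hh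
  set n := 2 ^ (m + 1) with hn
  have hnh : n = 2 * h := by rw [hn, hh]; ring
  have hh0 : 0 < h := by positivity
  have hn0 : n ≠ 0 := by omega
  -- The shift by `h` is forced: `cos (π/2) = 0` gives `z h = 1`.
  set g : Fin h → ℂ := fun s => (-1) ^ (h + (s : ℕ)) with hg
  let π : (ℕ → ℂ) → (Fin h → ℂ) := fun z s => z s
  have hπ : Continuous π := by fun_prop
  have hgcl : g ∈ closure (π '' cosOrbit n) := by
    rw [Metric.mem_closure_iff]
    intro ε hε
    obtain ⟨t, ht, hlt⟩ := exists_pos_forall_norm_exp_sub_lt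
      (fun s : Fin h => 2 * Real.cos (Real.pi * (s : ℕ) / n))
      (fun c hc => eq_zero_of_sum_mul_two_cos_eq_zero hh c hc) g (fun s => by simp [hg]) hε
    refine ⟨_, ⟨_, ⟨t, ht, rfl⟩, rfl⟩, ?_⟩
    rw [dist_comm, dist_pi_lt_iff hε]
    intro s
    rw [dist_eq_norm]
    exact hlt s
  -- Compactness makes the projected closure closed, so `g` lifts to a point of the orbit closure.
  have hgim : g ∈ π '' closure (cosOrbit n) :=
    closure_minimal (Set.image_mono subset_closure)
      ((isCompact_closure_cosOrbit n).image hπ).isClosed hgcl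
  obtain ⟨z, hz, hzg⟩ := hgim
  have hlow : ∀ s < h, z s = (-1) ^ (h + s) := fun s hs => congrFun hzg ⟨s, hs⟩
  have hmid : z h = 1 := by
    have := prod_eq_one_of_mem_closure_cosOrbit hz 1 (fun _ => h) (by
      have hh0' : (h : ℝ) ≠ 0 := by exact_mod_cast hh0.ne'
      rw [Finset.sum_range_one, hnh, show Real.pi * h / (2 * h : ℕ) = Real.pi / 2 by
        push_cast; field_simp]
      exact Real.cos_pi_div_two)
    simpa using this
  have hhalf : ∀ s < n, z s = (-1) ^ (h + s) := by
    intro s hs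
    rcases lt_trichotomy s h with hsh | hsh | hsh
    · exact hlow s hsh
    · rw [hsh, hmid, ← two_mul, pow_mul]
      simp
    · have h1 := mul_eq_one_of_mem_closure_cosOrbit hn0 hz hs.le
      rw [hlow (n - s) (by omega)] at h1
      have h2 : ((-1 : ℂ)) ^ (h + (n - s)) = (-1) ^ (h + s) :=
        neg_one_pow_congr (by simp only [Nat.even_iff]; omega)
      rw [h2] at h1
      have h3 : ((-1 : ℂ)) ^ (h + s) * (-1) ^ (h + s) = 1 := by rw [← mul_pow]; simp
      linear_combination ((-1 : ℂ)) ^ (h + s) * h1 - z s * h3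
  refine ⟨z, hz, (-1) ^ h, by simp, fun r hr hrn => ?_⟩
  rw [← pow_add, add_comm r h]
  rcases lt_or_gt_of_ne hrn with hlt | hgt
  · exact hhalf r hlt
  · rw [← apply_two_mul_sub_of_mem_closure_cosOrbit hn0 hz hr.le, hhalf _ (by omega)]
    exact neg_one_pow_congr (by simp only [Nat.even_iff]; omega)

theorem prettyGoodStateTransfer_pathGraph_two_pow (k : ℕ) (a b : Fin (2 ^ k))
    (hab : (b : ℕ) = 2 ^ k - 1 - a) :
    PrettyGoodStateTransfer (hamiltonianXYZ (SimpleGraph.pathGraph (2 ^ k))) a b := by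
  obtain ⟨z, hz, c, hc, hzc⟩ := exists_alternating_mem_closure_cosOrbit k
  refine (prettyGoodStateTransfer_pathGraph_iff a b).mpr ⟨z, hz, ?_⟩
  rw [hab, norm_pathAmplitude_rev_of_alternating a.2 hc hzc]

theorem theorem1 (n : ℕ) (hn : 1 ≤ n) :
    (PrettyGoodStateTransfer (hamiltonianXYZ (SimpleGraph.pathGraph n))
        (⟨0, by omega⟩ : Fin n) (⟨n - 1, by omega⟩ : Fin n) ↔ ∃ k : ℕ, n = 2 ^ k) ∧
    ((∃ k : ℕ, n = 2 ^ k) →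
      ∀ j : ℕ, ∀ (hj1 : 1 ≤ j) (hjn : j ≤ n),
        PrettyGoodStateTransfer (hamiltonianXYZ (SimpleGraph.pathGraph n))
          (⟨j - 1, by omega⟩ : Fin n) (⟨(n + 1 - j) - 1, by omega⟩ : Fin n)) := by
  refine ⟨⟨fun h => ?_, ?_⟩, ?_⟩
  · obtain ⟨z, hz, h1⟩ := (prettyGoodStateTransfer_pathGraph_iff _ _).mp h
    obtain ⟨c, hc⟩ := exists_alternating_of_one_le_norm_pathAmplitude hn
      (norm_eq_one_of_mem_closure_cosOrbit hz) h1
    exact exists_eq_two_pow_of_alternating_mem_closure_cosOrbit hn hz hc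
  · rintro ⟨k, rfl⟩
    exact prettyGoodStateTransfer_pathGraph_two_pow k _ _ (by simp)
  · rintro ⟨k, rfl⟩ j hj1 hjn
    exact prettyGoodStateTransfer_pathGraph_two_pow k _ _ (by simp only; omega)
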